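/- Let $R$ be a commutative von Neumann regular ring, i.e. an associative commutative ring with $1$ such that for every $a\in R$ there is $x\in R$ with $a=axa$. Call an $R$-module $M$ *Mittag-Leffler* if for every family $(Q_i)_{i\in I}$ of $R$-modules the canonical map $M\otimes_R\prod_{i\in I}Q_i\to\prod_{i\in I}(M\otimes_R Q_i)$ is injective, and *strict Mittag-Leffler* if for every homomorphism $u\colon F\to M$ with $F$ finitely presented there are a finitely presented module $S$ and a homomorphism $v\colon F\to S$ such that $u=v'v$ for some $v'\colon S\to M$, and such that for every module $B$ and every homomorphism $f\colon S\to B$ there is $g\colon M\to B$ with $gu=fv$. Then the following statements are equivalent: (i) $R$ is $\pi$-coherent, i.e. for every set $I$, every finitely generated submodule of $R^I$ is finitely presented; (ii) the class $\mathcal D$ of all flat Mittag-Leffler $R$-modules is closed under arbitrary direct products; (iii) $R$ is self-injective, i.e. $R$ is injective as an $R$-module; (iv) $R$ is strongly coherent, i.e. the class of all flat strict Mittag-Leffler $R$-modules is closed under arbitrary direct products. -/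

import Mathlib

universe u

/-- A ring is von Neumann regular if every element `a` has a quasi-inverse `x`: `a = a * x * a`. -/
def IsVonNeumannRegular (R : Type u) [Ring R] : Prop :=
  ∀ a : R, ∃ x : R, a = a * x * a

/-- `R` is π-coherent: for any set `I`, every finitely generated submodule of `R ^ I` is finitely
presented. (Over a commutative ring there is no distinction of sides.) -/
def IsPiCoherent (R : Type u) [CommRing R] : Prop :=
  ∀ (I : Type u) (N : Submodule R (I → R)), N.FG → Module.FinitePresentation R N

/-- `M` is Mittag-Leffler: for every family `(Q i)` of modules, the canonical map
`M ⊗ (∏ i, Q i) → ∏ i, (M ⊗ Q i)` is injective. -/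
def IsMittagLefflerModule (R : Type u) [CommRing R]
    (M : Type u) [AddCommGroup M] [Module R M] : Prop :=
  ∀ (I : Type u) (Q : I → Type u) [∀ i, AddCommGroup (Q i)] [∀ i, Module R (Q i)],
    Function.Injective (TensorProduct.piRightHom R R M Q)

/-- `M` is strict Mittag-Leffler: every homomorphism `a : F → M` from a finitely presented module
factors as `a = b ∘ v` through some `v : F → S` with `S` finitely presented, such that for every
`f : S → B` there is `g : M → B` with `g ∘ a = f ∘ v`. -/
def IsStrictMittagLefflerModule (R : Type u) [CommRing R]
    (M : Type u) [AddCommGroup M] [Module R M] : Prop :=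
  ∀ (F : Type u) [AddCommGroup F] [Module R F], Module.FinitePresentation R F →
    ∀ a : F →ₗ[R] M,
      ∃ (S : Type u) (_ : AddCommGroup S) (_ : Module R S) (v : F →ₗ[R] S),
        Module.FinitePresentation R S ∧
        (∃ b : S →ₗ[R] M, a = b ∘ₗ v) ∧
        ∀ (B : Type u) [AddCommGroup B] [Module R B] (f : S →ₗ[R] B),
          ∃ g : M →ₗ[R] B, g ∘ₗ a = f ∘ₗ v

/-- Membership in the class `𝒟` of flat Mittag-Leffler modules. -/
def IsFlatMittagLeffler (R : Type u) [CommRing R]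
    (M : Type u) [AddCommGroup M] [Module R M] : Prop :=
  Module.Flat R M ∧ IsMittagLefflerModule R M

/-- Membership in the class `𝒮𝒟` of flat strict Mittag-Leffler modules. -/
def IsFlatStrictMittagLeffler (R : Type u) [CommRing R]
    (M : Type u) [AddCommGroup M] [Module R M] : Prop :=
  Module.Flat R M ∧ IsStrictMittagLefflerModule R M

/-- A class `C` of `R`-modules is closed under (arbitrary direct) products. -/
def IsClosedUnderProducts (R : Type u) [CommRing R]
    (C : ∀ (M : Type u) [AddCommGroup M] [Module R M], Prop) : Prop :=
  ∀ (I : Type u) (M : I → Type u) [∀ i, AddCommGroup (M i)] [∀ i, Module R (M i)],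
    (∀ i, C (M i)) → C (∀ i, M i)

/-- `R` is strongly coherent: the class of flat strict Mittag-Leffler modules is closed under
products. -/
def IsStronglyCoherent (R : Type u) [CommRing R] : Prop :=
  IsClosedUnderProducts R (fun M _ _ => IsFlatStrictMittagLeffler R M)

/-!
A module over any commutative ring is flat and strict Mittag-Leffler exactly when it is locally
projective, and locally projective modules are Mittag-Leffler. Over a von Neumann regular ring `R`,
finitely generated ideals are generated by idempotents and all modules are flat, so in a
Mittag-Leffler module finitely generated submodules are finitely presented and the annihilator of
every element is generated by an idempotent `1 - e`; call `e` a support of the element.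

If `R` is self-injective and `J` is an ideal, then `J` embeds in `R ⧸ ann J` because `R` is reduced,
and extending the inclusion `J ⊆ R` along this embedding yields an idempotent `s` that fixes `J` and
is killed by `ann J`. Applied to the ideal generated by the supports of the coordinates, this shows
that supports exist in products. A support `e` of `x` gives, by injectivity, a linear form `h` with
`h x = e`, hence `h x • x = x`: modules with supports are locally projective.

Conversely, let `R` be π-coherent, `J` an ideal with inclusion `x : J → R`, and `f : J → R` linear.
Viewed in `R ^ J`, they satisfy `j • f = f j • x` for `j ∈ J`, so a support `e` of the class of `f`
modulo `R x` satisfies `j e = 0`. Thus `e • f = 0`, so `f ∈ R x`, which is Baer's criterion.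
-/

open TensorProduct

section Supports

variable {R : Type*} [CommRing R] {M : Type*} [AddCommGroup M] [Module R M]

/-- `e` is a support of `x`: it fixes `x` and is killed by the annihilator of `x`. Such an `e` is
idempotent and the annihilator of `x` is generated by `1 - e`. -/
def IsSupport (x : M) (e : R) : Prop :=
  e • x = x ∧ ∀ r : R, r • x = 0 → r * e = 0

variable (R M) in
/-- Every element of `M` has a support; equivalently, every cyclic submodule of `M` is
projective. -/
def HasSupports : Prop :=
  ∀ x : M, ∃ e : R, IsSupport x e

end Supports

section PseudoCoherent

variable {R : Type*} [Ring R] {M : Type*} [AddCommGroup M] [Module R M]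

variable (R M) in
/-- `M` is pseudo-coherent (Bourbaki's term): its finitely generated submodules are finitely
presented. -/
def IsPseudoCoherentModule : Prop :=
  ∀ N : Submodule R M, N.FG → Module.FinitePresentation R N

theorem IsPseudoCoherentModule.quotient (hM : IsPseudoCoherentModule R M) {P : Submodule R M}
    (hP : P.FG) : IsPseudoCoherentModule R (M ⧸ P) := fun K hK => by
  have hPK : P ≤ K.comap P.mkQ := P.le_comap_mkQ K
  have hfg : (K.comap P.mkQ).FG := by
    refine Submodule.fg_of_fg_map_of_fg_inf_ker P.mkQ ?_ ?_
    · rwa [Submodule.map_comap_eq_of_surjective P.mkQ_surjective]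
    · rwa [P.ker_mkQ, inf_eq_right.mpr hPK]
  have := hM _ hfg
  refine Module.finitePresentation_of_surjective (P.mkQ.submoduleComap K)
    (P.mkQ.submoduleComap_surjective_of_surjective K P.mkQ_surjective) ?_
  have hker : LinearMap.ker (P.mkQ.submoduleComap K) = P.comap (K.comap P.mkQ).subtype := by
    ext x
    simp [Subtype.ext_iff]
  refine Submodule.fg_of_fg_map_injective _ (K.comap P.mkQ).injective_subtype ?_
  rwa [hker, Submodule.map_comap_subtype, inf_eq_right.mpr hPK]

theorem IsPseudoCoherentModule.fg_ker_toSpanSingleton (hM : IsPseudoCoherentModule R M) (x : M) :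
    (LinearMap.ker (LinearMap.toSpanSingleton R M x)).FG := by
  have := hM (LinearMap.range (LinearMap.toSpanSingleton R M x)) (.of_finite)
  rw [← LinearMap.ker_rangeRestrict]
  exact Module.FinitePresentation.fg_ker _ (LinearMap.surjective_rangeRestrict _)

end PseudoCoherent

section LocallyProjective

variable {R : Type*} [CommRing R] {M : Type*} [AddCommGroup M] [Module R M]

variable (R M) in
/-- `M` is locally projective in the sense of Zimmermann-Huisgen: every `x : M` is fixed by an
endomorphism of the form `∑ k, h k (·) • y k` with linear forms `h k`. These endomorphisms are
encoded as the image of `Dual R M ⊗ M`. -/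
def IsLocallyProjectiveModule : Prop :=
  ∀ x : M, ∃ t : Module.Dual R M ⊗[R] M, dualTensorHom R M M t x = x

theorem isLocallyProjectiveModule_self : IsLocallyProjectiveModule R R := fun x =>
  ⟨LinearMap.id ⊗ₜ 1, by simp⟩

theorem dualTensorHom_rTensor_dualMap (p : M →ₗ[R] M) (t : Module.Dual R M ⊗[R] M) :
    dualTensorHom R M M (p.dualMap.rTensor M t) = dualTensorHom R M M t ∘ₗ p := by
  induction t with
  | zero => simp
  | add t₁ t₂ h₁ h₂ => simp only [map_add, h₁, h₂, LinearMap.add_comp]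
  | tmul h y => ext; simp

namespace IsLocallyProjectiveModule

-- If `p` fixes `s` and `q` fixes `a - p a`, then `1 - (1 - q) ∘ (1 - p)` fixes both `s` and `a`.
theorem exists_forall_mem_finset (hM : IsLocallyProjectiveModule R M) (s : Finset M) :
    ∃ t : Module.Dual R M ⊗[R] M, ∀ x ∈ s, dualTensorHom R M M t x = x := by
  classical
  induction s using Finset.induction_on with
  | empty => exact ⟨0, by simp⟩
  | insert a s _ ih =>
    obtain ⟨t, ht⟩ := ih
    set p := dualTensorHom R M M t
    obtain ⟨t', ht'⟩ := hM (a - p a)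
    refine ⟨t + (LinearMap.id - p).dualMap.rTensor M t', ?_⟩
    rw [map_add, dualTensorHom_rTensor_dualMap, Finset.forall_mem_insert]
    refine ⟨?_, fun x hx => ?_⟩
    · simp [p, ht']
    · simp [p, ht x hx]

theorem exists_dualBasis (hM : IsLocallyProjectiveModule R M) (s : Finset M) :
    ∃ (n : ℕ) (h : Fin n → Module.Dual R M) (y : Fin n → M),
      ∀ x ∈ s, ∑ k, h k x • y k = x := by
  obtain ⟨t, ht⟩ := hM.exists_forall_mem_finset s
  obtain ⟨n, h, y, rfl⟩ := TensorProduct.exists_sum_tmul_eq t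
  exact ⟨n, h, y, by simpa using ht⟩

theorem flat (hM : IsLocallyProjectiveModule R M) : Module.Flat R M := by
  classical
  refine Module.Flat.of_forall_isTrivialRelation fun {l f x} hfx => ?_
  obtain ⟨n, h, y, hy⟩ := hM.exists_dualBasis (Finset.univ.image x)
  refine ⟨n, fun i k => h k (x i), y, fun i => (hy _ (by simp)).symm, fun k => ?_⟩
  simpa using congrArg (h k) hfx

end IsLocallyProjectiveModule

end LocallyProjective

section StrictMittagLeffler

variable {R : Type u} [CommRing R] {M : Type u} [AddCommGroup M] [Module R M]

theorem rTensor_dualTensorHom_eq_zero {I : Type*} {Q : I → Type*} [∀ i, AddCommGroup (Q i)]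
    [∀ i, Module R (Q i)] {z : M ⊗[R] (∀ i, Q i)} (hz : piRightHom R R M Q z = 0)
    (t : Module.Dual R M ⊗[R] M) : (dualTensorHom R M M t).rTensor (∀ i, Q i) z = 0 := by
  induction t with
  | zero => simp
  | add t₁ t₂ h₁ h₂ => rw [map_add, LinearMap.rTensor_add, LinearMap.add_apply, h₁, h₂, add_zero]
  | tmul h y =>
    have hcoord : TensorProduct.lid R _ (h.rTensor (∀ i, Q i) z) = 0 := by
      ext i
      have hnat : LinearMap.proj i ∘ₗ (TensorProduct.lid R (∀ i, Q i)).toLinearMap ∘ₗ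
          h.rTensor (∀ i, Q i) =
          (TensorProduct.lid R (Q i)).toLinearMap ∘ₗ h.rTensor (Q i) ∘ₗ LinearMap.proj i ∘ₗ
            piRightHom R R M Q := by
        ext; simp
      simpa [hz] using LinearMap.congr_fun hnat z
    have hmk : (dualTensorHom R M M (h ⊗ₜ y)).rTensor (∀ i, Q i) =
        TensorProduct.mk R M _ y ∘ₗ (TensorProduct.lid R _).toLinearMap ∘ₗ
          h.rTensor (∀ i, Q i) := by
      ext; simp [TensorProduct.smul_tmul]
    simp [hmk, hcoord]

theorem IsLocallyProjectiveModule.isMittagLefflerModule (hM : IsLocallyProjectiveModule R M) :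
    IsMittagLefflerModule R M := by
  classical
  intro I Q _ _
  refine (injective_iff_map_eq_zero _).mpr fun z hz => ?_
  obtain ⟨s, m, q, rfl⟩ := TensorProduct.exists_sum_tmul_eq z
  obtain ⟨t, ht⟩ := hM.exists_forall_mem_finset (Finset.univ.image m)
  have hfix (j : Fin s) : dualTensorHom R M M t (m j) = m j := ht _ (by simp)
  simpa [hfix] using rTensor_dualTensorHom_eq_zero hz t

theorem IsLocallyProjectiveModule.isStrictMittagLefflerModule
    (hM : IsLocallyProjectiveModule R M) : IsStrictMittagLefflerModule R M := by
  classical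
  intro F _ _ _ a
  obtain ⟨s, hs⟩ := Module.Finite.fg_top (R := R) (M := F)
  obtain ⟨n, h, y, hy⟩ := hM.exists_dualBasis (s.image a)
  have hfactor : a = Fintype.linearCombination R y ∘ₗ LinearMap.pi h ∘ₗ a :=
    LinearMap.ext_on hs fun x hx => by
      simpa [Fintype.linearCombination_apply] using (hy _ (Finset.mem_image_of_mem a hx)).symm
  exact ⟨Fin n → R, inferInstance, inferInstance, LinearMap.pi h ∘ₗ a, inferInstance,
    ⟨Fintype.linearCombination R y, hfactor⟩, fun B _ _ f => ⟨f ∘ₗ LinearMap.pi h, rfl⟩⟩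

theorem IsFlatStrictMittagLeffler.isLocallyProjectiveModule
    (hM : IsFlatStrictMittagLeffler R M) : IsLocallyProjectiveModule R M := fun x => by
  have := hM.1
  obtain ⟨S, _, _, v, _, ⟨b, hb⟩, hfactor⟩ :=
    hM.2 R inferInstance (LinearMap.toSpanSingleton R M x)
  obtain ⟨g, hg⟩ := hfactor S LinearMap.id
  obtain ⟨k, c, d, rfl⟩ := Module.Flat.exists_factorization_of_finitePresentation b
  have hgx : g x = v 1 := by simpa using LinearMap.congr_fun hg 1
  have hx : x = d (c (v 1)) := by simpa using LinearMap.congr_fun hb 1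
  have hd (w : Fin k →₀ R) : ∑ i, w i • d (Finsupp.single i 1) = d w := by
    simp_rw [← map_smul, Finsupp.smul_single_one, ← map_sum, Finsupp.univ_sum_single]
  refine ⟨∑ i, (Finsupp.lapply i ∘ₗ c ∘ₗ g) ⊗ₜ d (Finsupp.single i 1), ?_⟩
  simp [hgx, hd, hx.symm]

theorem isFlatStrictMittagLeffler_iff_isLocallyProjectiveModule :
    IsFlatStrictMittagLeffler R M ↔ IsLocallyProjectiveModule R M :=
  ⟨fun hM => hM.isLocallyProjectiveModule, fun hM => ⟨hM.flat, hM.isStrictMittagLefflerModule⟩⟩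

theorem IsMittagLefflerModule.fg_ker_linearCombination (hM : IsMittagLefflerModule R M)
    (hflat : ∀ I : Type u, Module.Flat R (I → R)) {n : ℕ} (m : Fin n → M) :
    (LinearMap.ker (Fintype.linearCombination R m)).FG := by
  set K := LinearMap.ker (Fintype.linearCombination R m)
  let q : Fin n → K → R := fun i c => c.1 i
  have hzero : ∑ i, m i ⊗ₜ[R] q i = 0 := by
    refine (injective_iff_map_eq_zero _).mp (hM K fun _ => R) _ ?_
    ext c
    refine (TensorProduct.rid R M).injective ?_
    have hc : ∑ i, c.1 i • m i = 0 := c.2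
    simpa [q] using hc
  have := hflat K
  obtain ⟨k, a, y, hay, ha⟩ :=
    TensorProduct.vanishesTrivially_of_sum_tmul_eq_zero_of_rTensor_injective R
      (Module.Flat.rTensor_preserves_injective_linearMap _ (Submodule.injective_subtype _)) hzero
  suffices hspan : K = Submodule.span R (Set.range fun j i => a i j) by
    rw [hspan]
    exact Submodule.fg_span (Set.finite_range _)
  refine le_antisymm (fun c hc => ?_) (Submodule.span_le.mpr ?_)
  · refine (Submodule.mem_span_range_iff_exists_fun R).mpr
      ⟨fun j => y j ⟨c, hc⟩, funext fun i => ?_⟩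
    simpa [q, mul_comm] using (congrFun (hay i) ⟨c, hc⟩).symm
  · rintro _ ⟨j, rfl⟩
    simpa [K, Fintype.linearCombination_apply] using ha j

theorem IsMittagLefflerModule.isPseudoCoherentModule (hM : IsMittagLefflerModule R M)
    (hflat : ∀ I : Type u, Module.Flat R (I → R)) : IsPseudoCoherentModule R M := fun N hN => by
  obtain ⟨n, m, rfl⟩ := Submodule.fg_iff_exists_fin_generating_family.mp hN
  rw [← Fintype.range_linearCombination]
  refine Module.finitePresentation_of_surjective _ (LinearMap.surjective_rangeRestrict _) ?_
  rw [LinearMap.ker_rangeRestrict]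
  exact hM.fg_ker_linearCombination hflat m

end StrictMittagLeffler

namespace IsVonNeumannRegular

variable {R : Type*} [CommRing R]

theorem isReduced (hR : IsVonNeumannRegular R) : IsReduced R := by
  refine (isReduced_iff_pow_one_lt 2 one_lt_two).mpr fun a ha => ?_
  obtain ⟨x, hx⟩ := hR a
  rw [hx]
  linear_combination x * ha

theorem exists_isIdempotentElem_eq_span (hR : IsVonNeumannRegular R) {I : Ideal R} (hI : I.FG) :
    ∃ e : R, IsIdempotentElem e ∧ I = Ideal.span {e} := by
  refine (Ideal.isIdempotentElem_iff_of_fg I hI).mp (le_antisymm Ideal.mul_le_right fun a ha => ?_)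
  obtain ⟨x, hx⟩ := hR a
  rw [hx]
  exact Ideal.mul_mem_mul (I.mul_mem_right x ha) ha

theorem exists_sum_mul_mul_eq (hR : IsVonNeumannRegular R) {n : ℕ} (f : Fin n → R) :
    ∃ c : Fin n → R, ∀ j, (∑ i, f i * c i) * f j = f j := by
  obtain ⟨e, he, hspan⟩ := hR.exists_isIdempotentElem_eq_span
    (I := Ideal.span (Set.range f)) (Submodule.fg_span (Set.finite_range f))
  obtain ⟨c, hc⟩ : ∃ c : Fin n → R, ∑ i, c i * f i = e := by
    rw [← Ideal.mem_span_range_iff_exists_fun, hspan]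
    exact Ideal.mem_span_singleton_self e
  refine ⟨c, fun j => ?_⟩
  obtain ⟨y, hy⟩ : ∃ y, y * e = f j := by
    rw [← Ideal.mem_span_singleton', ← hspan]
    exact Ideal.subset_span ⟨j, rfl⟩
  simp_rw [mul_comm (f _) (c _), hc]
  rw [← hy, mul_left_comm, he.eq]

theorem flat (hR : IsVonNeumannRegular R) (M : Type*) [AddCommGroup M] [Module R M] :
    Module.Flat R M := by
  refine Module.Flat.of_forall_isTrivialRelation fun {l f x} hfx => ?_
  obtain ⟨c, hc⟩ := hR.exists_sum_mul_mul_eq f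
  -- The matrix `1 - c fᵀ` fixes the vector `x` because `fᵀ x = 0`, and `fᵀ` kills it by `hc`.
  refine ⟨l, fun i j => (if i = j then 1 else 0) - c i * f j, x, fun i => ?_, fun j => ?_⟩
  · simp [sub_smul, mul_smul, ← Finset.smul_sum, hfx]
  · simp [mul_sub, ← mul_assoc, ← Finset.sum_mul, hc]

theorem hasSupports (hR : IsVonNeumannRegular R) {M : Type*} [AddCommGroup M] [Module R M]
    (hM : IsPseudoCoherentModule R M) : HasSupports R M := fun x => by
  obtain ⟨e, he, hspan⟩ := hR.exists_isIdempotentElem_eq_span (hM.fg_ker_toSpanSingleton x)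
  have hann (r : R) : r • x = 0 ↔ ∃ a, a * e = r := by
    rw [← Ideal.mem_span_singleton', ← hspan, LinearMap.mem_ker, LinearMap.toSpanSingleton_apply]
  refine ⟨1 - e, ?_, fun r hr => ?_⟩
  · rw [sub_smul, one_smul, (hann e).mpr ⟨1, one_mul e⟩, sub_zero]
  · obtain ⟨a, rfl⟩ := (hann r).mp hr
    linear_combination -a * he.eq

end IsVonNeumannRegular

section SelfInjective

variable {R : Type u} [CommRing R] [Module.Injective R R]

theorem exists_dual_apply_eq {M : Type*} [AddCommGroup M] [Module R M] {x : M} {e : R}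
    (hxe : ∀ r : R, r • x = 0 → r * e = 0) : ∃ h : Module.Dual R M, h x = e := by
  let f : M →ₗ.[R] R := LinearPMap.mkSpanSingleton' x e hxe
  obtain ⟨h, hh⟩ := Module.Injective.extension_property R R _ _ f.domain.subtype
    f.domain.injective_subtype f.toFun
  refine ⟨h, ?_⟩
  have hx : x ∈ f.domain := Submodule.mem_span_singleton_self x
  exact (LinearMap.congr_fun hh ⟨x, hx⟩).trans
    (LinearPMap.mkSpanSingleton'_apply_self x e hxe hx)

theorem HasSupports.isLocallyProjectiveModule {M : Type*} [AddCommGroup M] [Module R M]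
    (hM : HasSupports R M) : IsLocallyProjectiveModule R M := fun x => by
  obtain ⟨e, he, hann⟩ := hM x
  obtain ⟨h, hh⟩ := exists_dual_apply_eq hann
  exact ⟨h ⊗ₜ x, by simpa [hh] using he⟩

theorem exists_mul_eq_self_and_annihilator_mul_eq_zero [IsReduced R] (J : Ideal R) :
    ∃ s : R, (∀ a ∈ J, s * a = a) ∧ ∀ r ∈ Submodule.annihilator J, r * s = 0 := by
  let A : Ideal R := Submodule.annihilator J
  have hinj : Function.Injective (A.mkQ ∘ₗ J.subtype) := by
    refine (injective_iff_map_eq_zero _).mpr fun a ha => Subtype.ext ?_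
    have haA : (a : R) ∈ A := (Submodule.Quotient.mk_eq_zero A).mp ha
    have haa : (a : R) * a = 0 := Submodule.mem_annihilator.mp haA a a.2
    exact pow_eq_zero_iff two_ne_zero |>.mp ((pow_two _).trans haa)
  obtain ⟨h, hh⟩ := Module.Injective.extension_property R R _ _ _ hinj J.subtype
  have hmul (r : R) : r * h (A.mkQ 1) = h (A.mkQ r) := by
    rw [← smul_eq_mul, ← map_smul, ← map_smul, smul_eq_mul, mul_one]
  refine ⟨h (A.mkQ 1), fun a ha => ?_, fun r hr => ?_⟩
  · rw [mul_comm, hmul]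
    exact LinearMap.congr_fun hh ⟨a, ha⟩
  · rw [hmul, Submodule.mkQ_apply, (Submodule.Quotient.mk_eq_zero A).mpr hr, map_zero]

theorem HasSupports.pi [IsReduced R] {I : Type*} {M : I → Type*} [∀ i, AddCommGroup (M i)]
    [∀ i, Module R (M i)] (hM : ∀ i, HasSupports R (M i)) : HasSupports R (∀ i, M i) := fun x => by
  choose e he hann using fun i => hM i (x i)
  obtain ⟨s, hs, hann_s⟩ :=
    exists_mul_eq_self_and_annihilator_mul_eq_zero (Ideal.span (Set.range e))
  refine ⟨s, funext fun i => ?_, fun r hr => hann_s r ?_⟩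
  · rw [Pi.smul_apply, ← he i, ← mul_smul, hs _ (Ideal.subset_span ⟨i, rfl⟩)]
  · rw [Submodule.mem_annihilator_span]
    rintro ⟨_, i, rfl⟩
    exact hann i r (congrFun hr i)

end SelfInjective

theorem IsPiCoherent.injective_self {R : Type u} [CommRing R] (h : IsPiCoherent R)
    (hR : IsVonNeumannRegular R) : Module.Injective R R := by
  refine Module.Baer.injective fun J f => ?_
  let x : J → R := fun j => j
  obtain ⟨e, he, hann⟩ :=
    hR.hasSupports (IsPseudoCoherentModule.quotient (h J) (Submodule.fg_span_singleton x))
      ((R ∙ x).mkQ f)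
  have hJe (j : J) : (j : R) * e = 0 := by
    refine hann j ?_
    rw [← map_smul, Submodule.mkQ_apply, Submodule.Quotient.mk_eq_zero,
      Submodule.mem_span_singleton]
    refine ⟨f j, funext fun i => ?_⟩
    change f j * (i : R) = j * f i
    rw [mul_comm, ← smul_eq_mul, ← map_smul, ← smul_eq_mul, ← map_smul]
    exact congrArg f (Subtype.ext (mul_comm _ _))
  have hef : e • (f : J → R) = 0 := funext fun j => by
    have : e • j = 0 := Subtype.ext ((mul_comm e j).trans (hJe j))
    rw [Pi.smul_apply, ← map_smul, this, map_zero, Pi.zero_apply]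
  rw [← map_smul, hef, map_zero, eq_comm, Submodule.mkQ_apply, Submodule.Quotient.mk_eq_zero] at he
  obtain ⟨c, hc⟩ := Submodule.mem_span_singleton.mp he
  exact ⟨LinearMap.lsmul R R c, fun r hr => congrFun hc ⟨r, hr⟩⟩

theorem mainTheorem8 (R : Type u) [CommRing R] (hR : IsVonNeumannRegular R) :
    List.TFAE
      [IsPiCoherent R,
       IsClosedUnderProducts R (fun M _ _ => IsFlatMittagLeffler R M),
       Module.Injective R R,
       IsStronglyCoherent R] := by
  have := hR.isReduced
  have hflat (I : Type u) : Module.Flat R (I → R) := hR.flat (I → R)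
  have hself : IsLocallyProjectiveModule R R := isLocallyProjectiveModule_self
  tfae_have 1 → 3 := fun h => h.injective_self hR
  tfae_have 3 → 2 := fun _ I M _ _ hM =>
    have hprod : IsLocallyProjectiveModule R (∀ i, M i) :=
      (HasSupports.pi fun i =>
        hR.hasSupports ((hM i).2.isPseudoCoherentModule hflat)).isLocallyProjectiveModule
    ⟨hprod.flat, hprod.isMittagLefflerModule⟩
  tfae_have 3 → 4 := fun _ I M _ _ hM =>
    isFlatStrictMittagLeffler_iff_isLocallyProjectiveModule.mpr
      (HasSupports.pi fun i => hR.hasSupports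
        ((hM i).isLocallyProjectiveModule.isMittagLefflerModule.isPseudoCoherentModule
          hflat)).isLocallyProjectiveModule
  tfae_have 2 → 1 := fun h I =>
    (h I (fun _ => R) fun _ => ⟨hself.flat, hself.isMittagLefflerModule⟩).2.isPseudoCoherentModule
      hflat
  tfae_have 4 → 1 := fun h I =>
    (h I (fun _ => R) fun _ => isFlatStrictMittagLeffler_iff_isLocallyProjectiveModule.mpr
      hself).isLocallyProjectiveModule.isMittagLefflerModule.isPseudoCoherentModule hflat
  tfae_finish
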